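/- For $x\in\mathbb{R}^n$ let $\|x\|_2=\bigl(\tfrac1n\sum_{i=1}^n |x_i|^2\bigr)^{1/2}$ be the normalized Euclidean norm and $\|x\|_\infty=\max_{i}|x_i|$ the max norm. For $\alpha\in(0,1]$ let $[0,1]^n_\alpha$ denote the $\alpha$-discretized cube, i.e. the set of all points of $[0,1]^n$ each of whose coordinates is an integer multiple of $\alpha$. **Theorem.** Let $p\in\{2,\infty\}$, let $\varepsilon,\lambda\ge 0$ and $\alpha\in(0,1]$, let $n\in\mathbb{N}$, and let $f:[0,1]^n_\alpha\to[0,1]^n_\alpha$ be $\lambda$-Lipschitz with respect to $\|\cdot\|_p$, i.e. $\|f(x)-f(y)\|_p\le\lambda\|x-y\|_p$ for all $x,y\in[0,1]^n_\alpha$. If $(\lambda+1)\,\alpha\le 2\varepsilon$, then $f$ has an $\varepsilon$-approximate fixed point, i.e. there is $x\in[0,1]^n_\alpha$ with $\|f(x)-x\|_p\le\varepsilon$. -/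

import Mathlib

open scoped ENNReal

/-- The normalized `ℓ_p` norm on `ℝⁿ`: `((1/n) ∑ᵢ |xᵢ|^p)^(1/p)` for finite `p`, and the max norm
`maxᵢ |xᵢ|` (the norm that Mathlib puts on `Fin n → ℝ`) for `p = ∞`. Meant for `1 ≤ p`. -/
noncomputable def normalizedNorm {n : ℕ} (p : ℝ≥0∞) (x : Fin n → ℝ) : ℝ :=
  if p = ∞ then ‖x‖
  else ((1 / (n : ℝ)) * ∑ i, |x i| ^ p.toReal) ^ (1 / p.toReal)

/-- `f : A → ℝᵐ`, with `A ⊆ ℝⁿ`, is `lam`-Lipschitz with respect to the normalized `ℓ_p` norms. -/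
def IsLipschitzInNorm {n m : ℕ} (p : ℝ≥0∞) (lam : ℝ) {A : Set (Fin n → ℝ)}
    (f : A → (Fin m → ℝ)) : Prop :=
  ∀ x y : A, normalizedNorm p (f x - f y) ≤
    lam * normalizedNorm p ((x : Fin n → ℝ) - (y : Fin n → ℝ))

/-- The `α`-discretized cube `[0,1]^n_α`: the points of `[0,1]ⁿ` all of whose coordinates are
integer multiples of `α`. -/
def discretizedCube (n : ℕ) (α : ℝ) : Set (Fin n → ℝ) :=
  {x | ∀ i, x i ∈ Set.Icc (0 : ℝ) 1 ∧ ∃ k : ℤ, x i = k * α}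

/-- `x ∈ A` is an `ε`-approximate fixed point of `f : A → A` in the normalized `ℓ_p` norm. -/
def IsApproxFixedPoint {n : ℕ} (p : ℝ≥0∞) (ε : ℝ) {A : Set (Fin n → ℝ)} (f : A → A) (x : A) :
    Prop :=
  normalizedNorm p ((f x : Fin n → ℝ) - (x : Fin n → ℝ)) ≤ ε

/-! Put b = ⌊1/α⌋α, the largest grid coordinate. It suffices to find z in [0, b]ⁿ with ‖f x - z‖ ≤
λ‖x - z‖ for every grid point x, as a fixed point of a λ-Lipschitz extension of f would satisfy.
Rounding z to a grid point x costs at most α/2 in norm, so ‖f x - x‖ ≤ ‖f x - z‖ + ‖z - x‖ ≤ (λ +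
1)α/2 ≤ ε.

For p = ∞, f is extended coordinatewise, clamped to the box, and Brouwer's theorem gives z
(`exists_common_norm_sub_le`). For p = 2 no extension is built: if every z violated some inequality,
averaging the values f x with weights proportional to the violations would be a continuous self-map
of the box. At its fixed point a variance inequality makes the weighted sum of violations
nonpositive, a contradiction (`exists_common_sum_sub_sq_le`).

Brouwer's theorem comes from Kuhn's labelling lemma, proved by a mod 2 Stokes argument on Kuhn's
triangulation (`sum_cupCoboundary_kuhnVertex`). -/

/-! ### Cochains modulo two -/

/-- The cup product of the coboundaries of the `0`-cochains `b 0, …, b (n - 1)`, modulo two,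
evaluated at the simplex with vertices `u 0, …, u n`. -/
def cupCoboundary {X : Type*} (b : ℕ → X → ZMod 2) (n : ℕ) (u : ℕ → X) : ZMod 2 :=
  ∏ i ∈ Finset.range n, (b i (u (i + 1)) + b i (u i))

/-- The sequence `u` with its `j`-th term left out. -/
def skipTerm {X : Type*} (j : ℕ) (u : ℕ → X) : ℕ → X :=
  fun i => if i < j then u i else u (i + 1)

theorem cupCoboundary_congr {X : Type*} (b : ℕ → X → ZMod 2) (n : ℕ) {u w : ℕ → X}
    (h : ∀ i ≤ n, u i = w i) : cupCoboundary b n u = cupCoboundary b n w := by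
  refine Finset.prod_congr rfl fun i hi => ?_
  have := Finset.mem_range.1 hi
  rw [h i (by omega), h (i + 1) (by omega)]

/-- A product of coboundaries is a cocycle. In the induction, the last factors of the final two
omissions add up to the last factor common to all the other omissions. -/
theorem sum_cupCoboundary_skipTerm {X : Type*} (b : ℕ → X → ZMod 2) (n : ℕ) (u : ℕ → X) :
    ∑ j ∈ Finset.range (n + 2), cupCoboundary b n (skipTerm j u) = 0 := by
  induction n with
  | zero => simp [cupCoboundary]; decide
  | succ n ih =>
    have hs : ∀ w : ℕ → X, cupCoboundary b (n + 1) w =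
        cupCoboundary b n w * (b n (w (n + 1)) + b n (w n)) := fun w =>
      Finset.prod_range_succ _ _
    have h1 : ∀ j ∈ Finset.range (n + 1), cupCoboundary b (n + 1) (skipTerm j u) =
        cupCoboundary b n (skipTerm j u) * (b n (u (n + 2)) + b n (u (n + 1))) := by
      intro j hj
      have := Finset.mem_range.1 hj
      rw [hs, skipTerm, skipTerm, if_neg (by omega), if_neg (by omega)]
    have h2 : cupCoboundary b n (skipTerm (n + 1 + 1) u) = cupCoboundary b n u :=
      cupCoboundary_congr b n fun i hi => if_pos (by omega)
    have h3 : cupCoboundary b n (skipTerm (n + 1) u) = cupCoboundary b n u :=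
      cupCoboundary_congr b n fun i hi => if_pos (by omega)
    rw [Finset.sum_range_succ] at ih
    rw [Finset.sum_range_succ, Finset.sum_range_succ, Finset.sum_congr rfl h1, ← Finset.sum_mul,
      hs, hs, h2]
    rw [h3] at ih ⊢
    have e1 : skipTerm (n + 1) u (n + 1) = u (n + 2) := by simp [skipTerm]
    have e2 : skipTerm (n + 1) u n = u n := by simp [skipTerm]
    have e3 : skipTerm (n + 1 + 1) u (n + 1) = u (n + 1) := by simp [skipTerm]
    have e4 : skipTerm (n + 1 + 1) u n = u n := by simp [skipTerm]
    rw [e1, e2, e3, e4]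
    have h4 : b n (u n) + b n (u n) = 0 := CharTwo.add_self_eq_zero _
    linear_combination (b n (u (n + 2)) + b n (u (n + 1))) * ih + cupCoboundary b n u * h4

/-- The coboundary formula for `b 0 ∪ δ (b 1) ∪ … ∪ δ (b n)`. -/
theorem cupCoboundary_succ_eq_sum {X : Type*} (b : ℕ → X → ZMod 2) (n : ℕ) (u : ℕ → X) :
    cupCoboundary b (n + 1) u = ∑ j ∈ Finset.range (n + 2),
      b 0 (skipTerm j u 0) * cupCoboundary (fun i => b (i + 1)) n (skipTerm j u) := by
  have h := sum_cupCoboundary_skipTerm (fun i => b (i + 1)) n u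
  rw [Finset.sum_range_succ'] at h ⊢
  have h1 : ∀ j ∈ Finset.range (n + 1),
      b 0 (skipTerm (j + 1) u 0) * cupCoboundary (fun i => b (i + 1)) n (skipTerm (j + 1) u) =
      b 0 (u 0) * cupCoboundary (fun i => b (i + 1)) n (skipTerm (j + 1) u) := by
    intro j _
    simp [skipTerm]
  have h2 : cupCoboundary b (n + 1) u =
      cupCoboundary (fun i => b (i + 1)) n (skipTerm 0 u) * (b 0 (u 1) + b 0 (u 0)) := by
    simp [cupCoboundary, Finset.prod_range_succ', skipTerm]
  have h3 : skipTerm 0 u 0 = u 1 := by simp [skipTerm]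
  rw [Finset.sum_congr rfl h1, ← Finset.mul_sum, h2, h3]
  have h4 : b 0 (u 0) * cupCoboundary (fun i => b (i + 1)) n (skipTerm 0 u)
    + b 0 (u 0) * cupCoboundary (fun i => b (i + 1)) n (skipTerm 0 u) = 0 :=
    CharTwo.add_self_eq_zero _
  linear_combination h4 - b 0 (u 0) * h

/-! ### Kuhn's triangulation and Sperner's lemma -/

/-- The `j`-th vertex of the simplex of Kuhn's triangulation that starts at `x` and raises
the coordinates in the order given by `ρ`. -/
def kuhnVertex {n : ℕ} (x : Fin n → ℕ) (ρ : Equiv.Perm (Fin n)) (j : ℕ) : Fin n → ℕ :=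
  fun k => x k + if (ρ k : ℕ) < j then 1 else 0

theorem skipTerm_kuhnVertex_swap {n : ℕ} (x : Fin (n + 1) → ℕ) (ρ : Equiv.Perm (Fin (n + 1)))
    {j : ℕ} (hj : j < n) :
    skipTerm (j + 1) (kuhnVertex x
      (Equiv.swap (⟨j, by omega⟩ : Fin (n + 1)) ⟨j + 1, by omega⟩ * ρ)) =
    skipTerm (j + 1) (kuhnVertex x ρ) := by
  have key : ∀ (i : ℕ), i ≠ j + 1 → ∀ r : Fin (n + 1),
      ((Equiv.swap (⟨j, by omega⟩ : Fin (n + 1)) ⟨j + 1, by omega⟩ r : Fin (n + 1)) : ℕ) < i ↔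
      (r : ℕ) < i := by
    intro i hi r
    rw [Equiv.swap_apply_def]
    split_ifs with h1 h2
    · subst h1; simp; omega
    · subst h2; simp; omega
    · rfl
  funext i k
  unfold skipTerm kuhnVertex
  split_ifs with h
  · simp only [Equiv.Perm.mul_apply, key i (by omega)]
  · simp only [Equiv.Perm.mul_apply, key (i + 1) (by omega)]

/-- A facet that omits an intermediate vertex lies in two simplices of the same cube, whose orders
differ by an adjacent transposition; modulo two they cancel. -/
theorem sum_skipTerm_kuhnVertex {n : ℕ} (x : Fin (n + 1) → ℕ) {j : ℕ} (hj : j < n)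
    (g : (ℕ → Fin (n + 1) → ℕ) → ZMod 2) :
    ∑ ρ : Equiv.Perm (Fin (n + 1)), g (skipTerm (j + 1) (kuhnVertex x ρ)) = 0 := by
  refine Finset.sum_involution
    (fun ρ _ => Equiv.swap (⟨j, by omega⟩ : Fin (n + 1)) ⟨j + 1, by omega⟩ * ρ) ?_ ?_ ?_ ?_
  · intro ρ _
    rw [skipTerm_kuhnVertex_swap x ρ hj]
    exact CharTwo.add_self_eq_zero _
  · intro ρ _ _ h
    rw [mul_eq_right, Equiv.swap_eq_one_iff] at h
    simp at h
  · simp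
  · simp

/-- The facet opposite the first vertex is the facet opposite the last vertex of a simplex in the
next cube, with the order rotated. Hence the outer facets telescope along rows of cubes. -/
theorem kuhnVertex_succ {n : ℕ} (x : Fin (n + 1) → ℕ) (ρ : Equiv.Perm (Fin (n + 1)))
    {i : ℕ} (hi : i ≤ n) :
    kuhnVertex x ρ (i + 1) =
      kuhnVertex (x + Pi.single (ρ.symm 0) 1) ((finRotate (n + 1))⁻¹ * ρ) i := by
  funext l
  obtain ⟨r, rfl⟩ := ρ.symm.surjective l
  have hr : (((finRotate (n + 1))⁻¹ * ρ) (ρ.symm r) : Fin (n + 1)) =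
      (finRotate (n + 1)).symm r := by
    simp [Equiv.Perm.mul_apply, Equiv.Perm.inv_def]
  unfold kuhnVertex
  rw [hr, Equiv.apply_symm_apply]
  refine Fin.cases ?_ (fun s => ?_) r
  · have : (finRotate (n + 1)).symm 0 = Fin.last n := by
      rw [Equiv.symm_apply_eq, finRotate_last]
    rw [this]
    simp; omega
  · have : (finRotate (n + 1)).symm s.succ = s.castSucc := by
      rw [Equiv.symm_apply_eq, finRotate_apply, Fin.coeSucc_eq_succ]
    rw [this]
    have h2 : ρ.symm s.succ ≠ ρ.symm 0 := fun h => Fin.succ_ne_zero s (ρ.symm.injective h)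
    simp [h2]

theorem sum_piFinset_insertNth {n : ℕ} (N : ℕ) (k : Fin (n + 1))
    (g : (Fin (n + 1) → ℕ) → ZMod 2) :
    ∑ x ∈ Fintype.piFinset (fun _ : Fin (n + 1) => Finset.range N), g x =
      ∑ y ∈ Fintype.piFinset (fun _ : Fin n => Finset.range N), ∑ t ∈ Finset.range N,
        g (k.insertNth t y) := by
  rw [← Finset.sum_product']
  symm
  refine Finset.sum_bij' (fun q _ => k.insertNth q.2 q.1)
    (fun x _ => (fun i => x (k.succAbove i), x k)) ?_ ?_ ?_ ?_ ?_
  · intro q hq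
    simp only [Finset.mem_product, Fintype.mem_piFinset] at hq ⊢
    intro a
    refine Fin.succAboveCases k ?_ (fun i => ?_) a
    · simpa using hq.2
    · simpa using hq.1 i
  · intro x hx
    simp only [Finset.mem_product, Fintype.mem_piFinset] at hx ⊢
    exact ⟨fun i => hx _, hx _⟩
  · intro q _
    simp
  · intro x _
    exact Fin.insertNth_self_removeNth k x
  · intro q _
    rfl

theorem sum_piFinset_telescope {n : ℕ} (N : ℕ) (k : Fin (n + 1))
    (g : (Fin (n + 1) → ℕ) → ZMod 2) :
    ∑ x ∈ Fintype.piFinset (fun _ : Fin (n + 1) => Finset.range N),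
        (g (x + Pi.single k 1) + g x) =
      ∑ y ∈ Fintype.piFinset (fun _ : Fin n => Finset.range N),
        (g (k.insertNth N y) + g (k.insertNth 0 y)) := by
  rw [sum_piFinset_insertNth N k]
  refine Finset.sum_congr rfl fun y _ => ?_
  have h : ∀ t : ℕ, (k.insertNth t y : Fin (n + 1) → ℕ) + Pi.single k 1 =
      k.insertNth (t + 1) y := by
    intro t
    funext a
    refine Fin.succAboveCases k ?_ (fun i => ?_) a
    · simp
    · simp
  simp_rw [h, ← CharTwo.sub_eq_add]
  exact Finset.sum_range_sub (fun t => g (k.insertNth t y)) N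

/-- A cubical form of Sperner's lemma: labels that take the value one on the lower faces of the
cube and zero on the upper faces have an odd number of completely labelled Kuhn simplices. -/
theorem sum_cupCoboundary_kuhnVertex (N n : ℕ) (a : ℕ → (Fin n → ℕ) → ZMod 2)
    (h0 : ∀ (i : Fin n) (x : Fin n → ℕ), x i = 0 → a i x = 1)
    (h1 : ∀ (i : Fin n) (x : Fin n → ℕ), x i = N → a i x = 0) :
    ∑ x ∈ Fintype.piFinset (fun _ : Fin n => Finset.range N), ∑ ρ : Equiv.Perm (Fin n),
      cupCoboundary a n (kuhnVertex x ρ) = 1 := by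
  induction n with
  | zero => simp [cupCoboundary]
  | succ n ih =>
    set b : ℕ → (Fin (n + 1) → ℕ) → ZMod 2 := fun i => a (i + 1) with hb
    set ω : (ℕ → Fin (n + 1) → ℕ) → ZMod 2 := fun w => a 0 (w 0) * cupCoboundary b n w with hω
    have hωc : ∀ u w : ℕ → Fin (n + 1) → ℕ, (∀ i ≤ n, u i = w i) → ω u = ω w := by
      intro u w h
      simp only [hω, cupCoboundary_congr b n h, h 0 (Nat.zero_le _)]
    have hr : ∀ ρ : Equiv.Perm (Fin (n + 1)),
        ((finRotate (n + 1))⁻¹ * ρ) (ρ.symm 0) = Fin.last n := by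
      intro ρ
      rw [Equiv.Perm.mul_apply, Equiv.apply_symm_apply, Equiv.Perm.inv_def, Equiv.symm_apply_eq,
        finRotate_last]
    have hx : ∀ x : Fin (n + 1) → ℕ,
        ∑ ρ : Equiv.Perm (Fin (n + 1)), cupCoboundary a (n + 1) (kuhnVertex x ρ) =
        ∑ ρ : Equiv.Perm (Fin (n + 1)),
          (ω (kuhnVertex (x + Pi.single (ρ.symm 0) 1) ((finRotate (n + 1))⁻¹ * ρ)) +
            ω (kuhnVertex x ((finRotate (n + 1))⁻¹ * ρ))) := by
      intro x
      simp_rw [cupCoboundary_succ_eq_sum]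
      rw [Finset.sum_comm, Finset.sum_range_succ', Finset.sum_range_succ,
        Finset.sum_eq_zero fun j hj => sum_skipTerm_kuhnVertex x (Finset.mem_range.1 hj) ω,
        zero_add, add_comm, Finset.sum_add_distrib]
      congr 1
      · refine Finset.sum_congr rfl fun ρ _ => hωc _ _ fun i hi => ?_
        rw [← kuhnVertex_succ x ρ hi]
        simp [skipTerm]
      · rw [← Equiv.sum_comp (Equiv.mulLeft (finRotate (n + 1))⁻¹)]
        refine Finset.sum_congr rfl fun ρ _ => hωc _ _ fun i hi => ?_
        exact if_pos (by omega)
    simp_rw [hx]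
    rw [Finset.sum_comm]
    simp_rw [fun ρ : Equiv.Perm (Fin (n + 1)) => sum_piFinset_telescope N (ρ.symm 0)
      (fun x => ω (kuhnVertex x ((finRotate (n + 1))⁻¹ * ρ)))]
    -- The rotated order raises coordinate `ρ.symm 0` last, so it is constant on the vertices 0, …,
    -- n.
    have hcoord : ∀ (ρ : Equiv.Perm (Fin (n + 1))) (c : ℕ) (y : Fin n → ℕ), ∀ i ≤ n,
        kuhnVertex ((ρ.symm 0).insertNth c y) ((finRotate (n + 1))⁻¹ * ρ) i (ρ.symm 0) = c := by
      intro ρ c y i hi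
      unfold kuhnVertex
      rw [hr]
      simp; omega
    -- Split by the value `ρ 0`. For `ρ 0 = 0` the label `a 0` is 0 on the upper face and 1 on the
    -- lower one, which leaves the claim one dimension down.
    rw [← Equiv.sum_comp Equiv.Perm.decomposeFin.symm, Fintype.sum_prod_type,
      Finset.sum_eq_single (0 : Fin (n + 1))]
    · rw [← ih (fun i y => a (i + 1) (Fin.cons 0 y))
        (fun i x hxi => by simpa using h0 i.succ (Fin.cons 0 x) (by simpa using hxi))
        (fun i x hxi => by simpa using h1 i.succ (Fin.cons 0 x) (by simpa using hxi)),
        Finset.sum_comm]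
      refine Finset.sum_congr rfl fun y _ => Finset.sum_congr rfl fun σ _ => ?_
      have hz : (Equiv.Perm.decomposeFin.symm ((0 : Fin (n + 1)), σ)).symm 0 = 0 := by
        rw [Equiv.symm_apply_eq]
        simp
      have hc := hcoord (Equiv.Perm.decomposeFin.symm ((0 : Fin (n + 1)), σ))
      rw [hz] at hc ⊢
      have e1 := h1 0 _ (hc N y 0 (Nat.zero_le _))
      have e0 := h0 0 _ (hc 0 y 0 (Nat.zero_le _))
      simp only [Fin.val_zero] at e1 e0
      simp only [hω]
      rw [e1, e0, zero_mul, zero_add, one_mul]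
      have hv : ∀ i ≤ n, kuhnVertex ((0 : Fin (n + 1)).insertNth 0 y)
          ((finRotate (n + 1))⁻¹ * Equiv.Perm.decomposeFin.symm ((0 : Fin (n + 1)), σ)) i =
          (Fin.cons 0 (kuhnVertex y σ i) : Fin (n + 1) → ℕ) := by
        intro i hi
        funext l
        refine Fin.cases ?_ (fun s => ?_) l
        · rw [hc 0 y i hi, Fin.cons_zero]
        · have : (finRotate (n + 1)).symm (σ s).succ = (σ s).castSucc := by
            rw [Equiv.symm_apply_eq, finRotate_apply, Fin.coeSucc_eq_succ]
          simp [kuhnVertex, Equiv.Perm.mul_apply, Equiv.Perm.inv_def, this]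
      rw [cupCoboundary_congr b n hv]
      rfl
    · intro p _ hp
      refine Finset.sum_eq_zero fun σ _ => Finset.sum_eq_zero fun y _ => ?_
      have hz : (Equiv.Perm.decomposeFin.symm (p, σ)).symm 0 ≠ 0 := by
        rw [Ne, Equiv.symm_apply_eq]
        simpa using hp.symm
      generalize Equiv.Perm.decomposeFin.symm (p, σ) = ρ at hz ⊢
      obtain ⟨s, hs⟩ := Fin.exists_succ_eq.2 hz
      have hvan : ∀ c : ℕ, (c = 0 ∨ c = N) →
          ω (kuhnVertex ((ρ.symm 0).insertNth c y) ((finRotate (n + 1))⁻¹ * ρ)) = 0 := by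
        intro c hcc
        -- On a face in direction `s.succ` the label `b s` is constant, so its coboundary vanishes.
        refine mul_eq_zero_of_right _ (Finset.prod_eq_zero (Finset.mem_range.2 s.2) ?_)
        have c1 := hcoord ρ c y (s + 1) s.2
        have c2 := hcoord ρ c y s s.2.le
        rcases hcc with rfl | rfl
        · have d1 := h0 _ _ c1
          have d2 := h0 _ _ c2
          rw [← hs] at d1 d2 ⊢
          simp only [Fin.val_succ] at d1 d2
          simp only [hb, d1, d2]
          decide
        · have d1 := h1 _ _ c1
          have d2 := h1 _ _ c2
          rw [← hs] at d1 d2 ⊢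
          simp only [Fin.val_succ] at d1 d2
          simp only [hb, d1, d2]
          decide
      rw [hvan N (Or.inr rfl), hvan 0 (Or.inl rfl), add_zero]
    · simp

theorem kuhnVertex_mem_Icc {n : ℕ} (x : Fin n → ℕ) (ρ : Equiv.Perm (Fin n)) (j : ℕ)
    (k : Fin n) : kuhnVertex x ρ j k ∈ Set.Icc (x k) (x k + 1) := by
  unfold kuhnVertex
  split_ifs <;> simp

/-- Kuhn's lemma: if each `P i` holds on the lower `i`-th face of a subdivided cube and fails on
the upper one, then some small cube has for each `i` a vertex with `P i` and one without. -/
theorem exists_completely_labelled_cube (N n : ℕ) (P : Fin n → (Fin n → ℕ) → Prop)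
    (h0 : ∀ (i : Fin n) (x : Fin n → ℕ), x i = 0 → P i x)
    (h1 : ∀ (i : Fin n) (x : Fin n → ℕ), x i = N → ¬ P i x) :
    ∃ x : Fin n → ℕ, (∀ k, x k < N) ∧ ∀ i, ∃ y z : Fin n → ℕ,
      (∀ k, y k ∈ Set.Icc (x k) (x k + 1)) ∧ (∀ k, z k ∈ Set.Icc (x k) (x k + 1)) ∧
      P i y ∧ ¬ P i z := by
  classical
  set a : ℕ → (Fin n → ℕ) → ZMod 2 := fun i x => if h : i < n then
    (if P ⟨i, h⟩ x then 1 else 0) else 0 with ha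
  have ha' : ∀ (i : Fin n) x, a i x = if P i x then 1 else 0 := by
    intro i x
    simp [ha]
  have key := sum_cupCoboundary_kuhnVertex N n a
    (fun i x hx => by rw [ha', if_pos (h0 i x hx)])
    (fun i x hx => by rw [ha', if_neg (h1 i x hx)])
  obtain ⟨x, hx, hx1⟩ := Finset.exists_ne_zero_of_sum_ne_zero (key.trans_ne one_ne_zero)
  obtain ⟨ρ, -, hρ⟩ := Finset.exists_ne_zero_of_sum_ne_zero hx1
  refine ⟨x, fun k => Finset.mem_range.1 (Fintype.mem_piFinset.1 hx k), fun i => ?_⟩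
  have hi := Finset.prod_ne_zero_iff.1 hρ i (Finset.mem_range.2 i.2)
  rw [ha', ha'] at hi
  have m := kuhnVertex_mem_Icc x ρ
  by_cases p1 : P i (kuhnVertex x ρ (i + 1)) <;> by_cases p2 : P i (kuhnVertex x ρ i)
  · rw [if_pos p1, if_pos p2] at hi
    exact absurd (by decide) hi
  · exact ⟨_, _, m _, m _, p1, p2⟩
  · exact ⟨_, _, m _, m _, p2, p1⟩
  · rw [if_neg p1, if_neg p2] at hi
    exact absurd (by decide) hi

/-! ### Brouwer's theorem -/

theorem exists_almost_fixed_cube {n : ℕ} {F : (Fin n → ℝ) → (Fin n → ℝ)}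
    (hm : Set.MapsTo F (Set.Icc 0 1) (Set.Icc 0 1)) (N : ℕ) :
    ∃ c ∈ Set.Icc (0 : Fin n → ℝ) 1, ∀ i, ∃ y ∈ Set.Icc (0 : Fin n → ℝ) 1,
      ∃ z ∈ Set.Icc (0 : Fin n → ℝ) 1, dist y c ≤ 1 / ((N : ℝ) + 1) ∧
        dist z c ≤ 1 / ((N : ℝ) + 1) ∧ y i ≤ F y i ∧ F z i ≤ z i := by
  have hN : (0 : ℝ) < (N : ℝ) + 1 := by positivity
  set s : (Fin n → ℕ) → Fin n → ℝ := fun x k => (x k : ℝ) / ((N : ℝ) + 1) with hs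
  obtain ⟨x, hx, h⟩ := exists_completely_labelled_cube (N + 1) n
    -- The label says that F does not lower coordinate i. Its values on the two i-th faces are
    -- forced; the wanted inequalities hold there because F preserves the cube.
    (fun i x => x i = 0 ∨ (x i < N + 1 ∧ s x i ≤ F (s x) i)) (fun i x hx => Or.inl hx)
    (fun i x hx => by omega)
  have hmem : ∀ y : Fin n → ℕ, (∀ k, y k ≤ N + 1) → s y ∈ Set.Icc (0 : Fin n → ℝ) 1 := by
    intro y hy
    refine ⟨fun k => by simp only [hs]; positivity, fun k => ?_⟩
    simp only [hs, Pi.one_apply]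
    rw [div_le_one hN]
    exact_mod_cast hy k
  have hdist : ∀ y : Fin n → ℕ, (∀ k, y k ∈ Set.Icc (x k) (x k + 1)) →
      dist (s y) (s x) ≤ 1 / ((N : ℝ) + 1) := by
    intro y hy
    refine (dist_pi_le_iff (by positivity)).2 fun k => ?_
    simp only [hs]
    rw [Real.dist_eq, ← sub_div, abs_div, abs_of_pos hN]
    refine div_le_div_of_nonneg_right ?_ hN.le
    have h1 : (x k : ℝ) ≤ y k := by exact_mod_cast (hy k).1
    have h2 : (y k : ℝ) ≤ x k + 1 := by exact_mod_cast (hy k).2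
    rw [abs_le]
    constructor <;> linarith
  refine ⟨s x, hmem x fun k => (hx k).le, fun i => ?_⟩
  obtain ⟨y, z, hy, hz, py, pz⟩ := h i
  have my := hmem y fun k => (hy k).2.trans (hx k)
  have mz := hmem z fun k => (hz k).2.trans (hx k)
  refine ⟨s y, my, s z, mz, hdist y hy, hdist z hz, ?_, ?_⟩
  · rcases py with h0 | h1
    · have : s y i = 0 := by simp [hs, h0]
      rw [this]
      exact (hm my).1 i
    · exact h1.2
  · by_contra hlt
    refine pz (Or.inr ⟨?_, (not_le.1 hlt).le⟩)
    by_contra hge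
    have hzi : z i = N + 1 := le_antisymm ((hz i).2.trans (hx i)) (not_lt.1 hge)
    have : s z i = 1 := by
      simp only [hs, hzi]
      push_cast
      exact div_self hN.ne'
    rw [this] at hlt
    exact hlt ((hm mz).2 i)

/-- Brouwer's fixed point theorem for the unit cube. -/
theorem exists_fixedPoint_of_continuousOn_cube {n : ℕ} {F : (Fin n → ℝ) → (Fin n → ℝ)}
    (hF : ContinuousOn F (Set.Icc 0 1)) (hm : Set.MapsTo F (Set.Icc 0 1) (Set.Icc 0 1)) :
    ∃ z ∈ Set.Icc (0 : Fin n → ℝ) 1, F z = z := by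
  choose c hc y hy z hz dy dz ly lz using exists_almost_fixed_cube hm
  obtain ⟨l, hl, φ, hφ, hlim⟩ := isCompact_Icc.tendsto_subseq hc
  refine ⟨l, hl, funext fun i => ?_⟩
  have h0 : Filter.Tendsto (fun N : ℕ => 1 / (((φ N : ℕ) : ℝ) + 1)) Filter.atTop (nhds 0) :=
    tendsto_one_div_add_atTop_nhds_zero_nat.comp hφ.tendsto_atTop
  have conv : ∀ w : ℕ → Fin n → ℝ, (∀ N, w N ∈ Set.Icc (0 : Fin n → ℝ) 1) →
      (∀ N, dist (w N) (c N) ≤ 1 / ((N : ℝ) + 1)) →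
      Filter.Tendsto (fun N => w (φ N) i) Filter.atTop (nhds (l i)) ∧
      Filter.Tendsto (fun N => F (w (φ N)) i) Filter.atTop (nhds (F l i)) := by
    intro w hw hd
    have h1 : Filter.Tendsto (fun N => w (φ N)) Filter.atTop (nhds l) := by
      refine (tendsto_iff_of_dist ?_).2 hlim
      exact squeeze_zero (fun _ => dist_nonneg) (fun N => hd (φ N)) h0
    have h2 : Filter.Tendsto (fun N => F (w (φ N))) Filter.atTop (nhds (F l)) :=
      (hF l hl).tendsto.comp
        (tendsto_nhdsWithin_iff.2 ⟨h1, Filter.Eventually.of_forall fun N => hw (φ N)⟩)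
    exact ⟨tendsto_pi_nhds.1 h1 i, tendsto_pi_nhds.1 h2 i⟩
  obtain ⟨y1, y2⟩ := conv (fun N => y N i) (fun N => hy N i) (fun N => dy N i)
  obtain ⟨z1, z2⟩ := conv (fun N => z N i) (fun N => hz N i) (fun N => dz N i)
  exact le_antisymm (le_of_tendsto_of_tendsto' z2 z1 fun N => lz (φ N) i)
    (le_of_tendsto_of_tendsto' y1 y2 fun N => ly (φ N) i)

/-- Precomposing with the retraction z ↦ z ⊓ b reduces this to the cube and also covers degenerate
boxes. -/
theorem exists_fixedPoint_of_continuousOn_box {n : ℕ} {b : Fin n → ℝ} (hb : b ∈ Set.Icc 0 1)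
    {F : (Fin n → ℝ) → (Fin n → ℝ)} (hF : ContinuousOn F (Set.Icc 0 b))
    (hm : Set.MapsTo F (Set.Icc 0 b) (Set.Icc 0 b)) :
    ∃ z ∈ Set.Icc (0 : Fin n → ℝ) b, F z = z := by
  have hr : Set.MapsTo (fun z : Fin n → ℝ => z ⊓ b) (Set.Icc 0 1) (Set.Icc 0 b) :=
    fun z hz => ⟨le_inf hz.1 hb.1, inf_le_right⟩
  obtain ⟨z, hz, h⟩ := exists_fixedPoint_of_continuousOn_cube (F := fun z => F (z ⊓ b))
    (hF.comp (continuous_pi fun i => (continuous_apply i).min continuous_const).continuousOn hr)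
    fun z hz => Set.Icc_subset_Icc_right hb.2 (hm (hr hz))
  have hzb : z ∈ Set.Icc 0 b := h ▸ hm (hr hz)
  refine ⟨z, hzb, ?_⟩
  simpa only [inf_eq_left.2 hzb.2] using h

/-! ### Fixed points of virtual Lipschitz extensions -/

theorem sum_sum_mul_sub_sq {ι : Type*} [Fintype ι] {p : ι → ℝ} (hp : ∑ x, p x = 1)
    (u : ι → ℝ) (c : ℝ) :
    ∑ x, ∑ y, p x * p y * (u x - u y) ^ 2 =
      2 * (∑ x, p x * (u x - c) ^ 2 - (∑ x, p x * u x - c) ^ 2) := by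
  have h1 : ∀ x y, p x * p y * (u x - u y) ^ 2 =
      p x * (u x - c) ^ 2 * p y + p x * (p y * (u y - c) ^ 2)
        - 2 * (p x * (u x - c) * (p y * (u y - c))) := fun x y => by ring
  have h2 : ∑ x, p x * (u x - c) = ∑ x, p x * u x - c := by
    simp_rw [mul_sub, Finset.sum_sub_distrib, ← Finset.sum_mul, hp, one_mul]
  simp_rw [h1, Finset.sum_sub_distrib, Finset.sum_add_distrib, ← Finset.mul_sum,
    ← Finset.sum_mul, hp, h2]
  ring

/-- Both sides are compared with mean squared pairwise differences: exactly for v, centred at its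
mean, and as an upper bound for u, since the mean minimizes the second moment. -/
theorem sum_mul_sum_sub_sq_le {ι κ : Type*} [Fintype ι] [Fintype κ] {p : ι → ℝ}
    (h0 : ∀ x, 0 ≤ p x) (hp : ∑ x, p x = 1) {C : ℝ} (hC : 0 ≤ C) (u v : ι → κ → ℝ)
    (h : ∀ x y, ∑ i, (v x i - v y i) ^ 2 ≤ C * ∑ i, (u x i - u y i) ^ 2) (c : κ → ℝ) :
    ∑ x, p x * ∑ i, (v x i - ∑ y, p y * v y i) ^ 2 ≤
      C * ∑ x, p x * ∑ i, (u x i - c i) ^ 2 := by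
  have hcomm : ∀ w : ι → κ → ℝ, ∑ i, ∑ x, ∑ y, p x * p y * (w x i - w y i) ^ 2 =
      ∑ x, ∑ y, p x * p y * ∑ i, (w x i - w y i) ^ 2 := by
    intro w
    simp_rw [Finset.mul_sum]
    rw [Finset.sum_comm]
    exact Finset.sum_congr rfl fun x _ => Finset.sum_comm
  have hcomm' : ∀ w d : ι → κ → ℝ, ∑ i, ∑ x, p x * (w x i - d x i) ^ 2 =
      ∑ x, p x * ∑ i, (w x i - d x i) ^ 2 := by
    intro w d
    simp_rw [Finset.mul_sum]
    exact Finset.sum_comm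
  have hv : 2 * ∑ x, p x * ∑ i, (v x i - ∑ y, p y * v y i) ^ 2 =
      ∑ x, ∑ y, p x * p y * ∑ i, (v x i - v y i) ^ 2 := by
    rw [← hcomm v, ← hcomm' v (fun _ i => ∑ y, p y * v y i), Finset.mul_sum]
    refine Finset.sum_congr rfl fun i _ => ?_
    rw [sum_sum_mul_sub_sq hp (fun x => v x i) (∑ y, p y * v y i)]
    ring
  have hu : ∑ x, ∑ y, p x * p y * ∑ i, (u x i - u y i) ^ 2 ≤
      2 * ∑ x, p x * ∑ i, (u x i - c i) ^ 2 := by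
    rw [← hcomm u, ← hcomm' u (fun _ i => c i), Finset.mul_sum]
    refine Finset.sum_le_sum fun i _ => ?_
    rw [sum_sum_mul_sub_sq hp (fun x => u x i) (c i)]
    nlinarith [sq_nonneg (∑ x, p x * u x i - c i)]
  have hle : ∑ x, ∑ y, p x * p y * ∑ i, (v x i - v y i) ^ 2 ≤
      C * ∑ x, ∑ y, p x * p y * ∑ i, (u x i - u y i) ^ 2 := by
    rw [Finset.mul_sum]
    simp_rw [Finset.mul_sum _ _ C]
    refine Finset.sum_le_sum fun x _ => Finset.sum_le_sum fun y _ => ?_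
    rw [mul_left_comm]
    exact mul_le_mul_of_nonneg_left (h x y) (mul_nonneg (h0 x) (h0 y))
  have := mul_le_mul_of_nonneg_left hu hC
  linarith

/-- The point of a Euclidean Lipschitz extension that is fixed by the extension. -/
theorem exists_common_sum_sub_sq_le {ι : Type*} [Fintype ι] {n : ℕ} {b : Fin n → ℝ}
    (hb : b ∈ Set.Icc 0 1) {C : ℝ} (hC : 0 ≤ C) (u v : ι → Fin n → ℝ)
    (hv : ∀ x, v x ∈ Set.Icc 0 b)
    (h : ∀ x y, ∑ i, (v x i - v y i) ^ 2 ≤ C * ∑ i, (u x i - u y i) ^ 2) :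
    ∃ z ∈ Set.Icc (0 : Fin n → ℝ) b, ∀ x,
      ∑ i, (v x i - z i) ^ 2 ≤ C * ∑ i, (u x i - z i) ^ 2 := by
  by_contra! hcon
  set g : ι → (Fin n → ℝ) → ℝ := fun x z =>
    ∑ i, (v x i - z i) ^ 2 - C * ∑ i, (u x i - z i) ^ 2 with hg
  set S : (Fin n → ℝ) → ℝ := fun z => ∑ x, max 0 (g x z) with hS
  set p : (Fin n → ℝ) → ι → ℝ := fun z x => max 0 (g x z) / S z with hpdef
  have hgc : ∀ x, Continuous (g x) := fun x => by fun_prop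
  have hSpos : ∀ z ∈ Set.Icc (0 : Fin n → ℝ) b, 0 < S z := by
    intro z hz
    obtain ⟨x, hx⟩ := hcon z hz
    exact Finset.sum_pos' (fun _ _ => le_max_left _ _)
      ⟨x, Finset.mem_univ _, lt_max_of_lt_right (sub_pos.2 hx)⟩
  have hp0 : ∀ z ∈ Set.Icc (0 : Fin n → ℝ) b, ∀ x, 0 ≤ p z x := fun z hz x =>
    div_nonneg (le_max_left _ _) (hSpos z hz).le
  have hp1 : ∀ z ∈ Set.Icc (0 : Fin n → ℝ) b, ∑ x, p z x = 1 := by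
    intro z hz
    simp only [hpdef]
    rw [← Finset.sum_div]
    exact div_self (hSpos z hz).ne'
  have hpc : ∀ x, ContinuousOn (fun z => p z x) (Set.Icc 0 b) := fun x =>
    (continuous_const.max (hgc x)).continuousOn.div
      (continuous_finsetSum _ fun x _ => continuous_const.max (hgc x)).continuousOn
      fun z hz => (hSpos z hz).ne'
  obtain ⟨z, hz, hfix⟩ := exists_fixedPoint_of_continuousOn_box hb
    (F := fun z i => ∑ x, p z x * v x i)
    (continuousOn_pi.2 fun i => continuousOn_finsetSum _ fun x _ =>
      (hpc x).mul continuousOn_const)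
    (fun z hz => ⟨fun i => Finset.sum_nonneg fun x _ => mul_nonneg (hp0 z hz x) ((hv x).1 i),
      fun i => by
        calc ∑ x, p z x * v x i ≤ ∑ x, p z x * b i := Finset.sum_le_sum fun x _ =>
              mul_le_mul_of_nonneg_left ((hv x).2 i) (hp0 z hz x)
          _ = b i := by rw [← Finset.sum_mul, hp1 z hz, one_mul]⟩)
  -- The fixed point z is the weighted mean of the v x, and it also serves as the centre for u.
  have hle := sum_mul_sum_sub_sq_le (hp0 z hz) (hp1 z hz) hC u v h z
  have hfix' : ∀ i, ∑ x, p z x * v x i = z i := fun i => congrFun hfix i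
  simp_rw [hfix'] at hle
  have hsum : ∑ x, p z x * g x z ≤ 0 := by
    simp only [hg, mul_sub, Finset.sum_sub_distrib]
    rw [Finset.mul_sum] at hle
    simp_rw [mul_left_comm C] at hle
    linarith
  have hterm : ∀ x, 0 ≤ p z x * g x z := by
    intro x
    rcases le_total (g x z) 0 with h' | h'
    · simp [hpdef, max_eq_left h']
    · exact mul_nonneg (hp0 z hz x) h'
  obtain ⟨x, hx⟩ := hcon z hz
  have hgx : 0 < g x z := sub_pos.2 hx
  have : 0 < p z x * g x z :=
    mul_pos (div_pos (lt_max_of_lt_right hgx) (hSpos z hz)) hgx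
  have := Finset.sum_pos' (fun x _ => hterm x) ⟨x, Finset.mem_univ _, this⟩
  linarith

theorem exists_common_norm_sub_le {n : ℕ} {b : Fin n → ℝ} (hb : b ∈ Set.Icc 0 1) {lam : ℝ}
    (hlam : 0 ≤ lam) {A : Set (Fin n → ℝ)} (f : A → Fin n → ℝ) (hf0 : ∀ x, f x ∈ Set.Icc 0 b)
    (hf : ∀ x y : A, ‖f x - f y‖ ≤ lam * ‖(x : Fin n → ℝ) - y‖) :
    ∃ z ∈ Set.Icc (0 : Fin n → ℝ) b, ∀ x : A, ‖f x - z‖ ≤ lam * ‖(x : Fin n → ℝ) - z‖ := by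
  classical
  set f' : (Fin n → ℝ) → Fin n → ℝ := fun x => if h : x ∈ A then f ⟨x, h⟩ else 0 with hf'
  have hfA : ∀ x : A, f' x = f x := fun x => by simp [hf']
  have hL : LipschitzOnWith ⟨lam, hlam⟩ f' A := by
    refine LipschitzOnWith.of_dist_le_mul fun x hx y hy => ?_
    rw [dist_eq_norm, dist_eq_norm, hfA ⟨x, hx⟩, hfA ⟨y, hy⟩]
    exact hf ⟨x, hx⟩ ⟨y, hy⟩
  obtain ⟨g, hg, hgA⟩ := hL.extend_pi
  have hgc := hg.continuous
  obtain ⟨z, hz, hfix⟩ := exists_fixedPoint_of_continuousOn_box hb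
    -- Clamping is 1-Lipschitz in each coordinate and fixes the values of f.
    (F := fun z => (0 ⊔ g z) ⊓ b)
    (continuous_pi fun i => (continuous_const.max ((continuous_apply i).comp hgc)).min
      continuous_const).continuousOn
    (fun z _ => ⟨le_inf le_sup_left hb.1, inf_le_right⟩)
  refine ⟨z, hz, fun x => ?_⟩
  have hgx : g x = f x := (hgA x.2).symm.trans (hfA x)
  have h1 : ‖f x - z‖ ≤ ‖g x - g z‖ := by
    refine (pi_norm_le_iff_of_nonneg (norm_nonneg _)).2 fun i => ?_
    refine le_trans ?_ (norm_le_pi_norm (g x - g z) i)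
    have hzi : z i = min (max 0 (g z i)) (b i) := (congrFun hfix i).symm
    have hfi : f x i = min (max 0 (f x i)) (b i) := by
      rw [max_eq_right (show 0 ≤ f x i from (hf0 x).1 i), min_eq_left ((hf0 x).2 i)]
    have h2 := abs_min_sub_min_le_max (max 0 (f x i)) (b i) (max 0 (g z i)) (b i)
    have h3 := abs_max_sub_max_le_abs (f x i) (g z i) 0
    rw [max_comm, max_comm (g z i)] at h3
    rw [← hzi, ← hfi, sub_self, abs_zero, max_eq_left (abs_nonneg _)] at h2
    rw [Pi.sub_apply, Pi.sub_apply, hgx]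
    exact h2.trans h3
  have h2 := hg.dist_le_mul (x : Fin n → ℝ) z
  rw [dist_eq_norm, dist_eq_norm] at h2
  exact h1.trans h2

/-! ### Normalized norms -/

theorem normalizedNorm_two {n : ℕ} (x : Fin n → ℝ) :
    normalizedNorm 2 x = √(∑ i, x i ^ 2) / √n := by
  rw [normalizedNorm, if_neg (by simp), ← Real.sqrt_div (by positivity), Real.sqrt_eq_rpow,
    one_div_mul_eq_div]
  simp

theorem normalizedNorm_top {n : ℕ} (x : Fin n → ℝ) : normalizedNorm ∞ x = ‖x‖ := if_pos rfl

theorem normalizedNorm_two_eq_norm {n : ℕ} (x : Fin n → ℝ) :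
    normalizedNorm 2 x = ‖WithLp.toLp 2 x‖ / √n := by
  rw [normalizedNorm_two, EuclideanSpace.norm_eq]
  simp

theorem normalizedNorm_add_le {p : ℝ≥0∞} (hp : p = 2 ∨ p = ∞) {n : ℕ} (x y : Fin n → ℝ) :
    normalizedNorm p (x + y) ≤ normalizedNorm p x + normalizedNorm p y := by
  rcases hp with rfl | rfl
  · simp_rw [normalizedNorm_two_eq_norm]
    rw [← add_div, WithLp.toLp_add]
    exact div_le_div_of_nonneg_right (norm_add_le _ _) (Real.sqrt_nonneg _)
  · simp_rw [normalizedNorm_top]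
    exact norm_add_le x y

theorem normalizedNorm_neg {p : ℝ≥0∞} {n : ℕ} (x : Fin n → ℝ) :
    normalizedNorm p (-x) = normalizedNorm p x := by
  simp [normalizedNorm]

theorem normalizedNorm_le_of_abs_le {p : ℝ≥0∞} (hp : p = 2 ∨ p = ∞) {n : ℕ} {x : Fin n → ℝ}
    {c : ℝ} (hc : 0 ≤ c) (h : ∀ i, |x i| ≤ c) : normalizedNorm p x ≤ c := by
  rcases hp with rfl | rfl
  · rw [normalizedNorm_two]
    refine div_le_of_le_mul₀ (Real.sqrt_nonneg _) hc ?_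
    rw [Real.sqrt_le_iff]
    refine ⟨by positivity, ?_⟩
    rw [mul_pow, Real.sq_sqrt (by positivity)]
    calc ∑ i, x i ^ 2 ≤ ∑ _i : Fin n, c ^ 2 :=
          Finset.sum_le_sum fun i _ => sq_le_sq' (abs_le.1 (h i)).1 (abs_le.1 (h i)).2
      _ = c ^ 2 * n := by simp [mul_comm]
  · rw [normalizedNorm_top]
    exact (pi_norm_le_iff_of_nonneg hc).2 h

theorem normalizedNorm_two_le_mul_iff {n : ℕ} {lam : ℝ} (hlam : 0 ≤ lam) (x y : Fin n → ℝ) :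
    normalizedNorm 2 x ≤ lam * normalizedNorm 2 y ↔
      ∑ i, x i ^ 2 ≤ lam ^ 2 * ∑ i, y i ^ 2 := by
  -- For n = 0 both inequalities read 0 ≤ 0; otherwise √n cancels.
  rcases Nat.eq_zero_or_pos n with rfl | hn
  · simp [normalizedNorm_two]
  · have : 0 < √(n : ℝ) := by positivity
    rw [normalizedNorm_two, normalizedNorm_two, ← mul_div_assoc, div_le_div_iff_of_pos_right this,
      Real.sqrt_le_iff, mul_pow, Real.sq_sqrt (by positivity)]
    exact and_iff_right (by positivity)

/-! ### Rounding to the grid -/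

theorem mem_Icc_floor_of_mem_discretizedCube {n : ℕ} {α : ℝ} (hα : 0 < α) {x : Fin n → ℝ}
    (hx : x ∈ discretizedCube n α) (i : Fin n) :
    ∃ k ∈ Set.Icc (0 : ℤ) ⌊1 / α⌋, x i = k * α := by
  obtain ⟨⟨h0, h1⟩, k, hk⟩ := hx i
  rw [hk] at h0 h1
  refine ⟨k, ⟨?_, ?_⟩, hk⟩
  · exact_mod_cast nonneg_of_mul_nonneg_left h0 hα
  · exact Int.le_floor.2 ((le_div_iff₀ hα).2 h1)

theorem finite_discretizedCube (n : ℕ) {α : ℝ} (hα : 0 < α) : (discretizedCube n α).Finite := by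
  refine (Set.Finite.pi' fun _ : Fin n =>
    (Set.finite_Icc (0 : ℤ) ⌊1 / α⌋).image fun k : ℤ => (k : ℝ) * α).subset fun x hx i => ?_
  obtain ⟨k, hk, h⟩ := mem_Icc_floor_of_mem_discretizedCube hα hx i
  exact ⟨k, hk, h.symm⟩

theorem floor_one_div_mul_le {α : ℝ} (hα : 0 < α) : (⌊1 / α⌋ : ℝ) * α ≤ 1 :=
  (le_div_iff₀ hα).1 (Int.floor_le _)

theorem exists_mem_discretizedCube_abs_sub_le {n : ℕ} {α : ℝ} (hα : 0 < α) {z : Fin n → ℝ}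
    (hz : z ∈ Set.Icc 0 (fun _ => (⌊1 / α⌋ : ℝ) * α)) :
    ∃ x ∈ discretizedCube n α, ∀ i, |x i - z i| ≤ α / 2 := by
  refine ⟨fun i => (round (z i / α) : ℝ) * α, fun i => ⟨⟨?_, ?_⟩, _, rfl⟩, fun i => ?_⟩
  · have h0 : 0 ≤ z i / α := div_nonneg (hz.1 i) hα.le
    have : 0 ≤ round (z i / α) := by
      rw [round_eq]
      exact Int.floor_nonneg.2 (by positivity)
    have : (0 : ℝ) ≤ round (z i / α) := by exact_mod_cast this
    positivity
  · have h1 : z i / α ≤ ⌊1 / α⌋ := (div_le_iff₀ hα).2 (hz.2 i)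
    have : round (z i / α) ≤ ⌊1 / α⌋ := by
      rw [round_eq, ← Int.lt_add_one_iff, Int.floor_lt]
      push_cast
      linarith
    have : (round (z i / α) : ℝ) ≤ ⌊1 / α⌋ := by exact_mod_cast this
    exact (mul_le_mul_of_nonneg_right this hα.le).trans (floor_one_div_mul_le hα)
  · have h := mul_le_mul_of_nonneg_right (abs_sub_round (z i / α)) hα.le
    rw [← abs_of_pos hα, ← abs_mul, abs_of_pos hα, sub_mul, div_mul_cancel₀ _ hα.ne',
      abs_sub_comm] at h
    linarith

theorem exists_common_normalizedNorm_sub_le {p : ℝ≥0∞} (hp : p = 2 ∨ p = ∞) {n : ℕ}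
    {b : Fin n → ℝ} (hb : b ∈ Set.Icc 0 1) {lam : ℝ} (hlam : 0 ≤ lam) {A : Set (Fin n → ℝ)}
    (hA : A.Finite) (f : A → Fin n → ℝ) (hf0 : ∀ x, f x ∈ Set.Icc 0 b)
    (hf : IsLipschitzInNorm p lam f) :
    ∃ z ∈ Set.Icc (0 : Fin n → ℝ) b, ∀ x : A,
      normalizedNorm p (f x - z) ≤ lam * normalizedNorm p ((x : Fin n → ℝ) - z) := by
  rcases hp with rfl | rfl
  · have := hA.fintype
    simp only [IsLipschitzInNorm, normalizedNorm_two_le_mul_iff hlam] at hf ⊢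
    exact exists_common_sum_sub_sq_le hb (sq_nonneg lam) (fun x : A => (x : Fin n → ℝ)) f hf0 hf
  · simp only [IsLipschitzInNorm, normalizedNorm_top] at hf ⊢
    exact exists_common_norm_sub_le hb hlam f hf0 hf

theorem mainTheorem9 (p : ℝ≥0∞) (hp : p = 2 ∨ p = ∞) (ε lam α : ℝ) (hε : 0 ≤ ε) (hlam : 0 ≤ lam)
    (hα : α ∈ Set.Ioc (0 : ℝ) 1) (n : ℕ)
    (f : discretizedCube n α → discretizedCube n α)
    (hf : IsLipschitzInNorm p lam (fun x => (f x : Fin n → ℝ)))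
    (h : (lam + 1) * α ≤ 2 * ε) :
    ∃ x : discretizedCube n α, IsApproxFixedPoint p ε f x := by
  have hα0 := hα.1
  have hfl : (0 : ℝ) ≤ ⌊1 / α⌋ := by
    exact_mod_cast Int.floor_nonneg.2 (one_div_nonneg.2 hα0.le)
  obtain ⟨z, hz, hfz⟩ := exists_common_normalizedNorm_sub_le hp
    -- With the box [0, 1]ⁿ instead, rounding z could leave the cube when 1/α is not an integer.
    (b := fun _ => (⌊1 / α⌋ : ℝ) * α)
    ⟨fun _ => mul_nonneg hfl hα0.le, fun _ => floor_one_div_mul_le hα0⟩ hlam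
    (finite_discretizedCube n hα0) (fun x => (f x : Fin n → ℝ))
    (fun x => ⟨fun i => ((f x).2 i).1.1, fun i => by
      obtain ⟨k, hk, e⟩ := mem_Icc_floor_of_mem_discretizedCube hα0 (f x).2 i
      rw [e]
      exact mul_le_mul_of_nonneg_right (Int.cast_le.2 hk.2) hα0.le⟩) hf
  obtain ⟨x, hx, hxz⟩ := exists_mem_discretizedCube_abs_sub_le hα0 hz
  refine ⟨⟨x, hx⟩, ?_⟩
  have hd : normalizedNorm p (x - z) ≤ α / 2 :=
    normalizedNorm_le_of_abs_le hp (by positivity) hxz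
  have h1 := (hfz ⟨x, hx⟩).trans (mul_le_mul_of_nonneg_left hd hlam)
  have h2 := normalizedNorm_add_le hp ((f ⟨x, hx⟩ : Fin n → ℝ) - z) (-(x - z))
  rw [normalizedNorm_neg, show (f ⟨x, hx⟩ : Fin n → ℝ) - z + -(x - z) = f ⟨x, hx⟩ - x by abel]
    at h2
  unfold IsApproxFixedPoint
  linarith
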